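/- Let $2<p_1,p_2<\infty$ and let $(C_n)_{n\ge 0}$ be a sequence of real numbers. Fix an offset $\theta\in\mathbb{R}$ and, for $k,m\in\mathbb{Z}$, let $P_{k,m}=[2^k(m+\theta),\,2^k(m+\theta+1)]$ be the intervals of length $2^k$ in the corresponding grid ($\theta=0$: the dyadic intervals; $\theta=-\tfrac12$: the intervals of length $2^k$ centred at the points $2^k m$), and $-P_{k,m}=\{-\xi:\xi\in P_{k,m}\}$. For every such interval $P=P_{k,m}$ let $\eta^1_{P}$ and $\eta^2_{-P}$ be functions on $\mathbb{R}$ whose Fourier transforms are smooth, vanish outside $P$ and outside $-P$ respectively, and satisfy $$\Big|\tfrac{d^n}{d\xi^n}\,\widehat{\eta^1_{P}}(\xi)\Big|\le C_n |P|^{-n},\qquad \Big|\tfrac{d^n}{d\xi^n}\,\widehat{\eta^2_{-P}}(\xi)\Big|\le C_n |P|^{-n}\qquad(n\ge 0,\ \xi\in\mathbb{R}).$$ (This includes the case of rescaled copies $\widehat{\eta^i_{I}}(\xi)=\widehat{\eta^i}(|I|^{-1}(\xi-c_I))$, $c_I$ the centre of $I$, of two fixed functions $\widehat{\eta^1},\widehat{\eta^2}\in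 C^\infty(\mathbb{R})$ supported in $[-\tfrac12,\tfrac12]$.) Then the operator $$\mathcal{B}(f_1,f_2)(x)=\sup_{k\in\mathbb{Z}}\Big|\sum_{|P|=2^k}(f_1*\eta^1_{P})(x)\,(f_2*\eta^2_{-P})(x)\Big|,$$ where the inner sum runs over all $P=P_{k,m}$, $m\in\mathbb{Z}$, is well defined on $L^{p_1}(\mathbb{R})\times L^{p_2}(\mathbb{R})$ (the convolutions exist and the sums converge absolutely at every $x\in\mathbb{R}$, and $\mathcal{B}(f_1,f_2)$ is measurable), it is sublinear in each argument, and it maps $L^{p_1}(\mathbb{R})\times L^{p_2}(\mathbb{R})$ boundedly into $L^{p_1p_2/(p_1+p_2)}(\mathbb{R})$: $$\|\mathcal{B}(f_1,f_2)\|_{\frac{p_1p_2}{p_1+p_2}}\le K\,\|f_1\|_{p_1}\|f_2\|_{p_2}\qquad\text{for all } f_1\in L^{p_1}(\mathbb{R}),\ f_2\in L^{p_2}(\mathbb{R}),$$ with a constant $K<\infty$ that depends only on $p_1$, $p_2$ and $(C_n)_{n\ge0}$. -/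

import Mathlib

open MeasureTheory
open scoped FourierTransform ContDiff ENNReal NNReal Convolution

noncomputable section

/-- The frequency intervals at scale `2 ^ k`: the `m`-th interval of length `2 ^ k` in the grid with
offset `θ`. The offset `θ = 0` gives the dyadic intervals `[2 ^ k m, 2 ^ k (m + 1)]`, the offset
`θ = - 1 / 2` gives the intervals of length `2 ^ k` centred at the points `2 ^ k m`. -/
def gridInterval (θ : ℝ) (k m : ℤ) : Set ℝ :=
  Set.Icc ((2 : ℝ) ^ k * (m + θ)) ((2 : ℝ) ^ k * (m + θ + 1))

/-- The reflected interval `-P = {-ξ : ξ ∈ P}`. -/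
def reflectedGridInterval (θ : ℝ) (k m : ℤ) : Set ℝ :=
  {ξ : ℝ | -ξ ∈ gridInterval θ k m}

/-- A family of smooth frequency cutoffs `φ k m`, uniformly adapted to the intervals `J k m`, which
are intervals of length `2 ^ k`: `φ k m` is smooth, vanishes off `J k m`, and
`|(d / dξ) ^ n (φ k m)| ≤ C n * (2 ^ k) ^ (-n)`. -/
structure IsAdaptedFamily (C : ℕ → ℝ) (J : ℤ → ℤ → Set ℝ) (φ : ℤ → ℤ → ℝ → ℂ) : Prop where
  smooth : ∀ k m, ContDiff ℝ ∞ (φ k m)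
  support_subset : ∀ k m, Function.support (φ k m) ⊆ J k m
  bound : ∀ (n : ℕ) (k m : ℤ) (ξ : ℝ),
    ‖iteratedDeriv n (φ k m) ξ‖ ≤ C n * (((2 : ℝ) ^ k) ^ n)⁻¹

/-- The frequency projection `f * η`, where `η` is the inverse Fourier transform (with kernel
`exp (2 π i x ξ)`) of the cutoff `φ`. -/
def freqProj (φ : ℝ → ℂ) (f : ℝ → ℂ) : ℝ → ℂ :=
  f ⋆[ContinuousLinearMap.mul ℂ ℂ, volume] (𝓕⁻ φ)

/-- The summand `(f₁ * η¹_P)(x) (f₂ * η²_{-P})(x)` for the `m`-th interval `P` of length `2 ^ k`. -/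
def tileTerm (φ₁ φ₂ : ℤ → ℤ → ℝ → ℂ) (f₁ f₂ : ℝ → ℂ) (k m : ℤ) (x : ℝ) : ℂ :=
  freqProj (φ₁ k m) f₁ x * freqProj (φ₂ k m) f₂ x

/-- The operator `B(f₁, f₂)(x) = sup_k |∑_{|P| = 2 ^ k} (f₁ * η¹_P)(x) (f₂ * η²_{-P})(x)|`,
with values in `[0, ∞]`. -/
def maxBilinear (φ₁ φ₂ : ℤ → ℤ → ℝ → ℂ) (f₁ f₂ : ℝ → ℂ) (x : ℝ) : ℝ≥0∞ :=
  ⨆ k : ℤ, ‖∑' m : ℤ, tileTerm φ₁ φ₂ f₁ f₂ k m x‖ₑ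

end

/-! No interaction between the two factors is needed beyond Cauchy–Schwarz in `m`: at each scale the
inner sum is at most the product of the two square functions `(∑ₘ |fᵢ * ηᵢ|²)^(1/2)`. Hence it
suffices to bound each square function, uniformly in the scale, by a function whose `L^p` norm is
controlled; Hölder then finishes.

Put `a = 2 ^ k` and `w(y) = (1 + (a y)²)⁻¹`. Each kernel is `w ψₘ`, where `ψₘ` is the inverse
Fourier transform of `φₘ - (a / 2π)² φₘ''` (`exists_schwartzMap_fourierInv_eq_one_add_sq_mul`).
Differentiation does not enlarge supports, so by Plancherel the `ψₘ` are orthogonal with squared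
norms at most `B² a` (`exists_orthogonal_kernels`). Bessel's inequality applied to `y ↦ f(y) w(x -
y)` bounds the squared square function at `x` by `B² a ∫ |f|² w(x - ·)`
(`tsum_enorm_freqProj_sq_le`), hence by `16 B² M(|f|²)(x)`, which does not depend on `k`. Since `p /
2 > 1`, the maximal theorem (`lintegral_dyadicMaximal_rpow_le`) gives the `L^p` bound. -/

/-! ### The Hardy–Littlewood maximal theorem. -/

/-- The centred Hardy-Littlewood maximal function over the radii `2 ^ k`. -/
noncomputable def dyadicMaximal (f : ℝ → ℝ≥0∞) (x : ℝ) : ℝ≥0∞ :=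
  ⨆ k : ℤ, (∫⁻ y in Metric.closedBall x ((2 : ℝ) ^ k), f y) / ENNReal.ofReal (2 * (2 : ℝ) ^ k)

theorem measurable_lintegral_closedBall {f : ℝ → ℝ≥0∞} (hf : Measurable f) (r : ℝ) :
    Measurable fun x : ℝ => ∫⁻ y in Metric.closedBall x r, f y := by
  have h : ∀ x : ℝ, ∫⁻ y in Metric.closedBall x r, f y =
      ∫⁻ y, ({z : ℝ × ℝ | dist z.2 z.1 ≤ r}.indicator (fun z => f z.2)) (x, y) := by
    intro x
    rw [← lintegral_indicator Metric.isClosed_closedBall.measurableSet]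
    rfl
  simp_rw [h]
  refine Measurable.lintegral_prod_right'
    (f := ({z : ℝ × ℝ | dist z.2 z.1 ≤ r}.indicator (fun z => f z.2))) ?_
  exact (hf.comp measurable_snd).indicator
    (measurableSet_le (by fun_prop) measurable_const)

theorem measurable_dyadicMaximal {f : ℝ → ℝ≥0∞} (hf : Measurable f) :
    Measurable (dyadicMaximal f) :=
  Measurable.iSup fun _ => (measurable_lintegral_closedBall hf _).div_const _

theorem lintegral_closedBall_le_dyadicMaximal (f : ℝ → ℝ≥0∞) (x : ℝ) (k : ℤ) :
    ∫⁻ y in Metric.closedBall x ((2 : ℝ) ^ k), f y ≤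
      ENNReal.ofReal (2 * (2 : ℝ) ^ k) * dyadicMaximal f x := by
  have hpos : 0 < 2 * (2 : ℝ) ^ k := by positivity
  rw [← ENNReal.div_le_iff' (ENNReal.ofReal_pos.2 hpos).ne' ENNReal.ofReal_ne_top]
  exact le_iSup (fun k : ℤ => (∫⁻ y in Metric.closedBall x ((2 : ℝ) ^ k), f y) /
    ENNReal.ofReal (2 * (2 : ℝ) ^ k)) k

/-- Weak type (1,1) by Vitali covering: disjoint balls with large averages, enlarged four times,
cover the superlevel set. The constant is the enlargement factor, since lengths scale linearly. -/
theorem mul_measure_dyadicMaximal_gt_le (f : ℝ → ℝ≥0∞) {t : ℝ} (ht : 0 < t) :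
    ENNReal.ofReal t * volume {x | ENNReal.ofReal t < dyadicMaximal f x} ≤ 4 * ∫⁻ y, f y := by
  by_cases hf : ∫⁻ y, f y = ⊤
  · simp [hf]
  have hex : ∀ x : {x | ENNReal.ofReal t < dyadicMaximal f x}, ∃ k : ℤ,
      ENNReal.ofReal t * ENNReal.ofReal (2 * (2 : ℝ) ^ k) ≤
        ∫⁻ y in Metric.closedBall x.1 ((2 : ℝ) ^ k), f y := by
    rintro ⟨x, hx⟩
    obtain ⟨k, hk⟩ := lt_iSup_iff.1 (show ENNReal.ofReal t < dyadicMaximal f x from hx)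
    have hpos : 0 < 2 * (2 : ℝ) ^ k := by positivity
    exact ⟨k, (ENNReal.le_div_iff_mul_le (.inl (ENNReal.ofReal_pos.2 hpos).ne')
      (.inl ENNReal.ofReal_ne_top)).1 hk.le⟩
  choose k hk using hex
  -- Vitali's lemma needs bounded radii; finiteness of `∫ f` supplies the bound.
  have hR : ∀ x ∈ (Set.univ : Set {x | ENNReal.ofReal t < dyadicMaximal f x}),
      (2 : ℝ) ^ k x ≤ (∫⁻ y, f y).toReal / t := by
    intro x _
    have h1 := (hk x).trans (setLIntegral_le_lintegral _ _)
    rw [← ENNReal.ofReal_mul ht.le, ENNReal.ofReal_le_iff_le_toReal hf] at h1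
    rw [le_div_iff₀ ht]
    have : (0 : ℝ) < 2 ^ k x := by positivity
    nlinarith
  obtain ⟨u, -, hdisj, hcov⟩ := Vitali.exists_disjoint_subfamily_covering_enlargement_closedBall
    Set.univ (fun x : {x | ENNReal.ofReal t < dyadicMaximal f x} => x.1) (fun x => (2 : ℝ) ^ k x)
    _ hR 4 (by norm_num)
  have hu : u.Countable := by
    refine hdisj.countable_of_nonempty_interior fun x _ => ?_
    rw [interior_closedBall _ (by positivity)]
    exact Metric.nonempty_ball.2 (by positivity)
  have hsub : {x | ENNReal.ofReal t < dyadicMaximal f x} ⊆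
      ⋃ b ∈ u, Metric.closedBall b.1 (4 * (2 : ℝ) ^ k b) := by
    intro x hx
    obtain ⟨b, hb, hb'⟩ := hcov ⟨x, hx⟩ trivial
    exact Set.mem_biUnion hb (hb' (Metric.mem_closedBall_self (by positivity)))
  calc ENNReal.ofReal t * volume {x | ENNReal.ofReal t < dyadicMaximal f x}
      ≤ ENNReal.ofReal t * ∑' b : u, volume (Metric.closedBall b.1.1 (4 * (2 : ℝ) ^ k b)) := by
        gcongr
        exact (measure_mono hsub).trans (measure_biUnion_le _ hu _)
    _ = 4 * ∑' b : u, ENNReal.ofReal t * ENNReal.ofReal (2 * (2 : ℝ) ^ k b.1) := by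
        rw [← ENNReal.tsum_mul_left, ← ENNReal.tsum_mul_left]
        congr 1 with b
        rw [Real.volume_closedBall, show 2 * (4 * (2 : ℝ) ^ k b.1) = 4 * (2 * (2 : ℝ) ^ k b.1) by
          ring, ENNReal.ofReal_mul (by norm_num : (0 : ℝ) ≤ 4)]
        simp only [ENNReal.ofReal_ofNat]
        ring
    _ ≤ 4 * ∑' b : u, ∫⁻ y in Metric.closedBall b.1.1 ((2 : ℝ) ^ k b), f y := by
        gcongr with b
        exact hk b.1
    _ = 4 * ∫⁻ y in ⋃ b ∈ u, Metric.closedBall b.1 ((2 : ℝ) ^ k b), f y := by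
        rw [lintegral_biUnion hu (fun b _ => Metric.isClosed_closedBall.measurableSet) hdisj]
    _ ≤ 4 * ∫⁻ y, f y := mul_le_mul' le_rfl (setLIntegral_le_lintegral _ _)

/-- The part of `f` below `t / 2` raises the maximal function by at most `t / 2`, so the weak bound
at height `t / 2` is needed only for the remaining part `g`. -/
theorem mul_measure_dyadicMaximal_gt_le_setLIntegral {f : ℝ → ℝ≥0∞} (hf : Measurable f) {t : ℝ}
    (ht : 0 < t) :
    ENNReal.ofReal t * volume {x | ENNReal.ofReal t < dyadicMaximal f x} ≤
      8 * ∫⁻ y in {y | ENNReal.ofReal t < 2 * f y}, f y := by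
  have hmeas : MeasurableSet {y | ENNReal.ofReal t < 2 * f y} :=
    measurableSet_lt measurable_const (hf.const_mul 2)
  set g := {y | ENNReal.ofReal t < 2 * f y}.indicator f with hg
  have hfg : ∀ y, f y ≤ g y + ENNReal.ofReal (t / 2) := by
    intro y
    by_cases hy : ENNReal.ofReal t < 2 * f y
    · rw [hg, Set.indicator_of_mem (show y ∈ {y | ENNReal.ofReal t < 2 * f y} from hy)]
      exact le_self_add
    · rw [ENNReal.ofReal_div_of_pos (by norm_num), ENNReal.ofReal_ofNat]
      refine le_add_left ((ENNReal.le_div_iff_mul_le (by simp) (by simp)).2 ?_)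
      rw [mul_comm]
      exact not_lt.1 hy
  have hM : ∀ x, dyadicMaximal f x ≤ dyadicMaximal g x + ENNReal.ofReal (t / 2) := by
    intro x
    refine iSup_le fun k => ?_
    have hpos : 0 < 2 * (2 : ℝ) ^ k := by positivity
    rw [ENNReal.div_le_iff' (ENNReal.ofReal_pos.2 hpos).ne' ENNReal.ofReal_ne_top, mul_add]
    calc _ ≤ ∫⁻ y in Metric.closedBall x ((2 : ℝ) ^ k), (g y + ENNReal.ofReal (t / 2)) :=
          lintegral_mono fun y => hfg y
      _ = (∫⁻ y in Metric.closedBall x ((2 : ℝ) ^ k), g y) +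
            ENNReal.ofReal (2 * (2 : ℝ) ^ k) * ENNReal.ofReal (t / 2) := by
          rw [lintegral_add_right _ measurable_const, setLIntegral_const, Real.volume_closedBall,
            mul_comm (ENNReal.ofReal (t / 2))]
      _ ≤ _ := by
          gcongr
          exact lintegral_closedBall_le_dyadicMaximal g x k
  have hsub : {x | ENNReal.ofReal t < dyadicMaximal f x} ⊆
      {x | ENNReal.ofReal (t / 2) < dyadicMaximal g x} := by
    intro x hx
    by_contra h
    have h1 : dyadicMaximal f x ≤ ENNReal.ofReal (t / 2) + ENNReal.ofReal (t / 2) :=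
      (hM x).trans (add_le_add_left (not_lt.1 h) _)
    rw [← ENNReal.ofReal_add (by positivity) (by positivity), add_halves] at h1
    exact absurd hx (not_lt.2 h1)
  calc _ ≤ ENNReal.ofReal t * volume {x | ENNReal.ofReal (t / 2) < dyadicMaximal g x} := by
        gcongr
    _ = 2 * (ENNReal.ofReal (t / 2) * volume {x | ENNReal.ofReal (t / 2) < dyadicMaximal g x}) := by
        rw [← mul_assoc, ← ENNReal.ofReal_ofNat 2, ← ENNReal.ofReal_mul (by norm_num)]
        congr 2
        ring
    _ ≤ 2 * (4 * ∫⁻ y, g y) :=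
        mul_le_mul' le_rfl (mul_measure_dyadicMaximal_gt_le g (by positivity))
    _ = _ := by
        rw [hg, lintegral_indicator hmeas, ← mul_assoc]
        norm_num

/-- The layer-cake identity for a single value, with `a = ∞` allowed. -/
theorem lintegral_Ioi_indicator_rpow {q : ℝ} (hq : 0 < q) (a : ℝ≥0∞) :
    ∫⁻ t in Set.Ioi (0 : ℝ), {t : ℝ | ENNReal.ofReal t < a}.indicator
      (fun t => ENNReal.ofReal (q * t ^ (q - 1))) t = a ^ q := by
  have hfin : ∀ b : ℝ, 0 ≤ b → ∫⁻ t in Set.Ioi (0 : ℝ),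
      {t : ℝ | ENNReal.ofReal t < ENNReal.ofReal b}.indicator
      (fun t => ENNReal.ofReal (q * t ^ (q - 1))) t = ENNReal.ofReal (b ^ q) := by
    intro b hb
    have hm : MeasurableSet {t : ℝ | ENNReal.ofReal t < ENNReal.ofReal b} :=
      measurableSet_lt (by fun_prop) measurable_const
    rw [lintegral_indicator hm, Measure.restrict_restrict hm]
    have hset : {t : ℝ | ENNReal.ofReal t < ENNReal.ofReal b} ∩ Set.Ioi 0 = Set.Ioo 0 b := by
      ext t
      simp only [Set.mem_inter_iff, Set.mem_ofPred_eq, Set.mem_Ioi, Set.mem_Ioo]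
      constructor
      · rintro ⟨h1, h2⟩
        exact ⟨h2, (ENNReal.ofReal_lt_ofReal_iff_of_nonneg h2.le).1 h1⟩
      · rintro ⟨h1, h2⟩
        exact ⟨(ENNReal.ofReal_lt_ofReal_iff_of_nonneg h1.le).2 h2, h1⟩
    rw [hset, ← ofReal_integral_eq_lintegral_ofReal]
    · rw [← integral_Ioc_eq_integral_Ioo, ← intervalIntegral.integral_of_le hb,
        intervalIntegral.integral_const_mul, integral_rpow (.inl (by linarith))]
      congr 1
      rw [sub_add_cancel, Real.zero_rpow hq.ne']
      field_simp
      ring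
    · have := (intervalIntegral.intervalIntegrable_rpow' (a := 0) (b := b)
        (r := q - 1) (by linarith)).const_mul q
      rw [intervalIntegrable_iff_integrableOn_Ioc_of_le hb] at this
      exact this.mono_set Set.Ioo_subset_Ioc_self
    · filter_upwards [ae_restrict_mem measurableSet_Ioo] with t ht
      have := Real.rpow_nonneg ht.1.le (q - 1)
      simp only [Pi.zero_apply]
      positivity
  rcases eq_or_ne a ⊤ with rfl | ha
  · rw [ENNReal.top_rpow_of_pos hq]
    refine ENNReal.eq_top_of_forall_nnreal_le fun c => ?_
    -- The truncation height `c^(1/q)` makes the truncated integral exactly `c`, so the full one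
    -- exceeds every `c`.
    have h := hfin ((c : ℝ) ^ (q⁻¹ : ℝ)) (by positivity)
    rw [Real.rpow_inv_rpow c.coe_nonneg hq.ne', ENNReal.ofReal_coe_nnreal] at h
    rw [← h]
    refine lintegral_mono fun t => ?_
    exact Set.indicator_le_indicator_of_subset (fun s _ => ENNReal.ofReal_lt_top)
      (fun _ => zero_le) t
  · have h := hfin a.toReal ENNReal.toReal_nonneg
    rwa [ENNReal.ofReal_toReal ha, ← ENNReal.ofReal_rpow_of_nonneg ENNReal.toReal_nonneg hq.le,
      ENNReal.ofReal_toReal ha] at h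

/-- Marcinkiewicz interpolation: the layer-cake formula for the maximal function, the refined weak
bound, Tonelli, and the layer-cake formula again, now for `2 f` with exponent `q - 1`. -/
theorem lintegral_dyadicMaximal_rpow_le {q : ℝ} (hq : 1 < q) {f : ℝ → ℝ≥0∞} (hf : Measurable f) :
    ∫⁻ x, dyadicMaximal f x ^ q ≤
      ENNReal.ofReal (8 * q / (q - 1) * 2 ^ (q - 1)) * ∫⁻ x, f x ^ q := by
  have hM := measurable_dyadicMaximal hf
  have hq1 : 0 < q - 1 := by linarith
  -- The spare factor `t` is consumed by the weak bound; what remains is the layer-cake density for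
  -- `q - 1`.
  have hpow : ∀ t ∈ Set.Ioi (0 : ℝ), ENNReal.ofReal (q * t ^ (q - 1)) =
      ENNReal.ofReal (q / (q - 1)) * ENNReal.ofReal ((q - 1) * t ^ (q - 1 - 1)) *
        ENNReal.ofReal t := by
    intro t ht
    have ht : 0 < t := ht
    rw [← ENNReal.ofReal_mul (by positivity), ← ENNReal.ofReal_mul (by positivity)]
    congr 1
    rw [Real.rpow_sub_one ht.ne' (q - 1)]
    field_simp
  have hm1 : MeasurableSet {z : ℝ × ℝ | ENNReal.ofReal z.2 < dyadicMaximal f z.1} :=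
    measurableSet_lt (by fun_prop) (hM.comp measurable_fst)
  calc ∫⁻ x, dyadicMaximal f x ^ q
      = ∫⁻ x, ∫⁻ t in Set.Ioi (0 : ℝ), {t : ℝ | ENNReal.ofReal t < dyadicMaximal f x}.indicator
          (fun t => ENNReal.ofReal (q * t ^ (q - 1))) t := by
        simp_rw [lintegral_Ioi_indicator_rpow (by linarith : 0 < q)]
    _ = ∫⁻ t in Set.Ioi (0 : ℝ), ∫⁻ x, {t : ℝ | ENNReal.ofReal t < dyadicMaximal f x}.indicator
          (fun t => ENNReal.ofReal (q * t ^ (q - 1))) t := by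
        refine lintegral_lintegral_swap (Measurable.aemeasurable ?_)
        exact Measurable.indicator (f := fun z : ℝ × ℝ => ENNReal.ofReal (q * z.2 ^ (q - 1)))
          (by fun_prop) hm1
    _ = ∫⁻ t in Set.Ioi (0 : ℝ), ENNReal.ofReal (q * t ^ (q - 1)) *
          volume {x | ENNReal.ofReal t < dyadicMaximal f x} := by
        congr 1 with t
        rw [← lintegral_indicator_const (measurableSet_lt measurable_const hM)]
        rfl
    _ ≤ ∫⁻ t in Set.Ioi (0 : ℝ), ENNReal.ofReal (q / (q - 1)) *
          ENNReal.ofReal ((q - 1) * t ^ (q - 1 - 1)) *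
          (8 * ∫⁻ y in {y | ENNReal.ofReal t < 2 * f y}, f y) := by
        refine setLIntegral_mono' measurableSet_Ioi fun t ht => ?_
        rw [hpow t ht, mul_assoc]
        exact mul_le_mul' le_rfl (mul_measure_dyadicMaximal_gt_le_setLIntegral hf ht)
    _ = ∫⁻ t in Set.Ioi (0 : ℝ), ∫⁻ x, 8 * ENNReal.ofReal (q / (q - 1)) *
          (f x * {t : ℝ | ENNReal.ofReal t < 2 * f x}.indicator
          (fun t => ENNReal.ofReal ((q - 1) * t ^ (q - 1 - 1))) t) := by
        congr 1 with t
        have hmt : MeasurableSet {y | ENNReal.ofReal t < 2 * f y} :=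
          measurableSet_lt measurable_const (hf.const_mul 2)
        rw [← lintegral_indicator hmt, mul_left_comm, ← mul_assoc,
          ← lintegral_const_mul _ (hf.indicator hmt)]
        congr 1 with x
        by_cases hx : ENNReal.ofReal t < 2 * f x
        · rw [Set.indicator_of_mem (show x ∈ {y | ENNReal.ofReal t < 2 * f y} from hx),
            Set.indicator_of_mem (show t ∈ {t : ℝ | ENNReal.ofReal t < 2 * f x} from hx)]
          ring
        · rw [Set.indicator_of_notMem (show x ∉ {y | ENNReal.ofReal t < 2 * f y} from hx),
            Set.indicator_of_notMem (show t ∉ {t : ℝ | ENNReal.ofReal t < 2 * f x} from hx)]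
          simp
    _ = ∫⁻ x, ∫⁻ t in Set.Ioi (0 : ℝ), 8 * ENNReal.ofReal (q / (q - 1)) *
          (f x * {t : ℝ | ENNReal.ofReal t < 2 * f x}.indicator
          (fun t => ENNReal.ofReal ((q - 1) * t ^ (q - 1 - 1))) t) := by
        refine lintegral_lintegral_swap (Measurable.aemeasurable ?_)
        refine Measurable.const_mul (Measurable.mul (hf.comp measurable_snd) ?_) _
        exact Measurable.indicator
          (f := fun z : ℝ × ℝ => ENNReal.ofReal ((q - 1) * z.1 ^ (q - 1 - 1))) (by fun_prop)
          (measurableSet_lt (by fun_prop) ((hf.comp measurable_snd).const_mul 2))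
    _ = ∫⁻ x, 8 * ENNReal.ofReal (q / (q - 1)) * (f x * (2 * f x) ^ (q - 1)) := by
        congr 1 with x
        have hmt : Measurable ({t : ℝ | ENNReal.ofReal t < 2 * f x}.indicator
          (fun t => ENNReal.ofReal ((q - 1) * t ^ (q - 1 - 1)))) :=
          Measurable.indicator (by fun_prop) (measurableSet_lt (by fun_prop) measurable_const)
        rw [lintegral_const_mul _ (hmt.const_mul _), lintegral_const_mul _ hmt,
          lintegral_Ioi_indicator_rpow hq1]
    _ = _ := by
        rw [← lintegral_const_mul _ (hf.pow_const q)]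
        congr 1 with x
        have h : f x ^ q = f x * f x ^ (q - 1) := by
          conv_lhs => rw [show q = 1 + (q - 1) by ring,
            ENNReal.rpow_add_of_nonneg _ _ zero_le_one hq1.le, ENNReal.rpow_one]
        rw [h, ENNReal.mul_rpow_of_nonneg _ _ hq1.le, ENNReal.ofReal_mul (by positivity),
          mul_div_assoc, ENNReal.ofReal_mul (by norm_num : (0 : ℝ) ≤ 8),
          ← ENNReal.ofReal_rpow_of_pos (by norm_num : (0 : ℝ) < 2)]
        simp only [ENNReal.ofReal_ofNat]
        ring

/-! ### Weighted averages dominated by the maximal function. -/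

theorem ofReal_inv_one_add_sq_le_tsum (k : ℤ) (s : ℝ) :
    ENNReal.ofReal (1 + ((2 : ℝ) ^ k * s) ^ 2)⁻¹ ≤
      ∑' j : ℕ, ENNReal.ofReal (4 * (4⁻¹ : ℝ) ^ j) *
        (Metric.closedBall 0 ((2 : ℝ) ^ ((j : ℤ) - k))).indicator 1 s := by
  have hk : (0 : ℝ) < 2 ^ k := by positivity
  have hex : ∃ j : ℕ, (2 : ℝ) ^ k * |s| ≤ 2 ^ j :=
    (pow_unbounded_of_one_lt _ one_lt_two).imp fun _ h => h.le
  classical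
  -- With `j` minimal, either `j = 0` and the weight is at most 1, or `2 ^ k |s| > 2 ^ (j - 1)` and
  -- the weight is at most `4 * 4⁻ʲ`.
  set j := Nat.find hex
  have hj : (2 : ℝ) ^ k * |s| ≤ 2 ^ j := Nat.find_spec hex
  refine le_trans ?_ (ENNReal.le_tsum j)
  have hmem : s ∈ Metric.closedBall (0 : ℝ) ((2 : ℝ) ^ ((j : ℤ) - k)) := by
    rw [mem_closedBall_zero_iff, Real.norm_eq_abs, zpow_sub₀ (by norm_num), zpow_natCast,
      le_div_iff₀ hk, mul_comm]
    exact hj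
  rw [Set.indicator_of_mem hmem, Pi.one_apply, mul_one]
  refine ENNReal.ofReal_le_ofReal ?_
  rcases Nat.eq_zero_or_pos j with h0 | h0
  · rw [h0, pow_zero]
    refine (inv_le_one_of_one_le₀ ?_).trans (by norm_num)
    nlinarith [sq_nonneg ((2 : ℝ) ^ k * s)]
  · obtain ⟨i, hi⟩ : ∃ i, j = i + 1 := ⟨j - 1, by omega⟩
    have hlt : (2 : ℝ) ^ i < 2 ^ k * |s| := not_le.1 (Nat.find_min hex (by omega : i < j))
    have hsq : (4 : ℝ) ^ i ≤ ((2 : ℝ) ^ k * s) ^ 2 := by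
      calc (4 : ℝ) ^ i = (2 ^ i) ^ 2 := by rw [← pow_mul, mul_comm, pow_mul]; norm_num
        _ ≤ (2 ^ k * |s|) ^ 2 := by gcongr
        _ = _ := by rw [mul_pow, sq_abs, mul_pow]
    have : (4 : ℝ) * 4⁻¹ ^ j = (4 ^ i)⁻¹ := by
      rw [hi, pow_succ, inv_pow]
      ring
    rw [this]
    gcongr
    linarith

/-- The decay `4⁻ʲ` of the weight beats the growth `2ʲ` of the balls; the terms are `8 * 2⁻ʲ`, with
sum 16. -/
theorem lintegral_mul_kernel_le_dyadicMaximal {f : ℝ → ℝ≥0∞} (hf : Measurable f) (k : ℤ) (x : ℝ) :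
    ENNReal.ofReal ((2 : ℝ) ^ k) *
      ∫⁻ y, f y * ENNReal.ofReal (1 + ((2 : ℝ) ^ k * (x - y)) ^ 2)⁻¹ ≤
      16 * dyadicMaximal f x := by
  have hk : (0 : ℝ) < 2 ^ k := by positivity
  have hind : ∀ (j : ℕ) (y : ℝ), f y * (ENNReal.ofReal (4 * (4⁻¹ : ℝ) ^ j) *
        (Metric.closedBall 0 ((2 : ℝ) ^ ((j : ℤ) - k))).indicator 1 (x - y)) =
      ENNReal.ofReal (4 * (4⁻¹ : ℝ) ^ j) *
        (Metric.closedBall x ((2 : ℝ) ^ ((j : ℤ) - k))).indicator f y := by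
    intro j y
    have hiff : x - y ∈ Metric.closedBall (0 : ℝ) ((2 : ℝ) ^ ((j : ℤ) - k)) ↔
        y ∈ Metric.closedBall x ((2 : ℝ) ^ ((j : ℤ) - k)) := by
      rw [mem_closedBall_zero_iff, Metric.mem_closedBall, dist_comm, dist_eq_norm]
    by_cases h : y ∈ Metric.closedBall x ((2 : ℝ) ^ ((j : ℤ) - k))
    · rw [Set.indicator_of_mem h, Set.indicator_of_mem (hiff.2 h), Pi.one_apply]
      ring
    · rw [Set.indicator_of_notMem h, Set.indicator_of_notMem (mt hiff.1 h)]
      simp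
  have hmball : ∀ r : ℝ, MeasurableSet (Metric.closedBall x r) :=
    fun r => Metric.isClosed_closedBall.measurableSet
  calc _ ≤ ENNReal.ofReal ((2 : ℝ) ^ k) * ∫⁻ y, ∑' j : ℕ, ENNReal.ofReal (4 * (4⁻¹ : ℝ) ^ j) *
        (Metric.closedBall x ((2 : ℝ) ^ ((j : ℤ) - k))).indicator f y := by
        gcongr with y
        simp_rw [← hind, ENNReal.tsum_mul_left]
        gcongr
        exact ofReal_inv_one_add_sq_le_tsum k (x - y)
    _ = ENNReal.ofReal ((2 : ℝ) ^ k) * ∑' j : ℕ, ENNReal.ofReal (4 * (4⁻¹ : ℝ) ^ j) *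
        ∫⁻ y in Metric.closedBall x ((2 : ℝ) ^ ((j : ℤ) - k)), f y := by
        rw [lintegral_tsum fun j => ((hf.indicator (hmball _)).const_mul _).aemeasurable]
        congr 2 with j
        rw [lintegral_const_mul _ (hf.indicator (hmball _)), lintegral_indicator (hmball _)]
    _ ≤ ENNReal.ofReal ((2 : ℝ) ^ k) * ∑' j : ℕ, ENNReal.ofReal (4 * (4⁻¹ : ℝ) ^ j) *
        (ENNReal.ofReal (2 * (2 : ℝ) ^ ((j : ℤ) - k)) * dyadicMaximal f x) := by
        gcongr with j
        exact lintegral_closedBall_le_dyadicMaximal f x _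
    _ = (∑' j : ℕ, ENNReal.ofReal (8 * (1 / 2 : ℝ) ^ j)) * dyadicMaximal f x := by
        rw [← ENNReal.tsum_mul_left, ← ENNReal.tsum_mul_right]
        congr 1 with j
        rw [← mul_assoc, ← mul_assoc, ← ENNReal.ofReal_mul (by positivity),
          ← ENNReal.ofReal_mul (by positivity)]
        congr 2
        have h4 : (4⁻¹ : ℝ) ^ j = (1 / 2) ^ j * (1 / 2) ^ j := by rw [← mul_pow]; norm_num
        have h2 : (1 / 2 : ℝ) ^ j * 2 ^ j = 1 := by rw [← mul_pow]; norm_num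
        have hz : (2 : ℝ) ^ k * 2 ^ ((j : ℤ) - k) = 2 ^ j := by
          rw [← zpow_add₀ (by norm_num), add_sub_cancel, zpow_natCast]
        rw [h4]
        linear_combination 8 * (1 / 2 : ℝ) ^ j * h2 + 8 * ((1 / 2 : ℝ) ^ j * (1 / 2) ^ j) * hz
    _ = _ := by
        rw [← ENNReal.ofReal_tsum_of_nonneg (fun j => by positivity)
          (summable_geometric_two.mul_left 8), tsum_mul_left, tsum_geometric_two]
        norm_num

/-! ### Bessel's inequality for orthogonal families. -/

/-- The vectors are not normalised and may vanish. Pairing `g` with `h = ∑ ⟨vᵢ, g⟩ vᵢ` gives `S`,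
while orthogonality gives `‖h‖² ≤ D S`; Cauchy–Schwarz then yields `S² ≤ D S ‖g‖²`. -/
theorem sum_norm_inner_sq_le_of_orthogonal {E ι : Type*} [NormedAddCommGroup E]
    [InnerProductSpace ℂ E] {v : ι → E} {D : ℝ} (hD0 : 0 ≤ D)
    (hort : ∀ i j, i ≠ j → inner ℂ (v i) (v j) = 0) (hD : ∀ i, ‖v i‖ ^ 2 ≤ D) (s : Finset ι) (g : E) :
    ∑ i ∈ s, ‖inner ℂ (v i) g‖ ^ 2 ≤ D * ‖g‖ ^ 2 := by
  classical
  set S := ∑ i ∈ s, ‖inner ℂ (v i) g‖ ^ 2 with hS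
  have hS0 : 0 ≤ S := Finset.sum_nonneg fun _ _ => by positivity
  set h : E := ∑ i ∈ s, (inner ℂ (v i) g : ℂ) • v i with hh
  have h1 : inner ℂ h g = (S : ℂ) := by
    rw [hh, sum_inner, hS]
    push_cast
    refine Finset.sum_congr rfl fun i _ => ?_
    rw [inner_smul_left, RCLike.conj_mul]
    rfl
  have h2 : ‖h‖ ^ 2 ≤ D * S := by
    have h3 : inner ℂ h h = ((∑ i ∈ s, ‖inner ℂ (v i) g‖ ^ 2 * ‖v i‖ ^ 2 : ℝ) : ℂ) := by
      conv_lhs => rw [hh]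
      rw [sum_inner]
      push_cast
      refine Finset.sum_congr rfl fun i hi => ?_
      rw [inner_smul_left, inner_sum, Finset.sum_eq_single i, inner_smul_right,
        inner_self_eq_norm_sq_to_K, ← mul_assoc, RCLike.conj_mul]
      · rfl
      · intro j _ hj
        rw [inner_smul_right, hort i j hj.symm, mul_zero]
      · exact fun h => absurd hi h
    rw [inner_self_eq_norm_sq_to_K] at h3
    have h4 : ‖h‖ ^ 2 = ∑ i ∈ s, ‖inner ℂ (v i) g‖ ^ 2 * ‖v i‖ ^ 2 := by
      apply Complex.ofReal_injective
      rw [← h3, Complex.ofReal_pow]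
      rfl
    rw [h4, hS, Finset.mul_sum]
    refine Finset.sum_le_sum fun i _ => ?_
    rw [mul_comm D]
    gcongr
    exact hD i
  have h5 : S ≤ ‖h‖ * ‖g‖ := by
    have := norm_inner_le_norm (𝕜 := ℂ) h g
    rwa [h1, Complex.norm_real, Real.norm_of_nonneg hS0] at this
  rcases hS0.eq_or_lt with h0 | h0
  · rw [← h0] at h2 ⊢
    positivity
  · have h6 : S * S ≤ S * (D * ‖g‖ ^ 2) := by
      calc S * S ≤ (‖h‖ * ‖g‖) * (‖h‖ * ‖g‖) := by gcongr
        _ = ‖h‖ ^ 2 * ‖g‖ ^ 2 := by ring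
        _ ≤ (D * S) * ‖g‖ ^ 2 := by gcongr
        _ = _ := by ring
    exact le_of_mul_le_mul_left h6 h0

theorem sum_norm_integral_mul_sq_le {ι : Type*} {e : ι → ℝ → ℂ} {g : ℝ → ℂ} {D : ℝ} (hD0 : 0 ≤ D)
    (he : ∀ i, MemLp (e i) 2 volume)
    (hort : ∀ i j, i ≠ j → ∫ y, inner ℂ (e i y) (e j y) = 0)
    (hD : ∀ i, ∫ y, ‖e i y‖ ^ 2 ≤ D) (hg : MemLp g 2 volume) (s : Finset ι) :
    ∑ i ∈ s, ‖∫ y, g y * e i y‖ ^ 2 ≤ D * ∫ y, ‖g y‖ ^ 2 := by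
  have hL2 : ∀ {u w : ℝ → ℂ} (hu : MemLp u 2 volume) (hw : MemLp w 2 volume),
      inner ℂ (hu.toLp u) (hw.toLp w) = ∫ y, inner ℂ (u y) (w y) := by
    intro u w hu hw
    rw [L2.inner_def]
    refine integral_congr_ae ?_
    filter_upwards [hu.coeFn_toLp, hw.coeFn_toLp] with y h1 h2
    rw [h1, h2]
  have hnorm : ∀ {u : ℝ → ℂ} (hu : MemLp u 2 volume), ‖hu.toLp u‖ ^ 2 = ∫ y, ‖u y‖ ^ 2 := by
    intro u hu
    have h := hL2 hu hu
    simp_rw [inner_self_eq_norm_sq_to_K] at h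
    have h' : ((‖hu.toLp u‖ ^ 2 : ℝ) : ℂ) = ∫ y, ((‖u y‖ ^ 2 : ℝ) : ℂ) := by
      push_cast
      exact h
    rw [integral_complex_ofReal] at h'
    exact_mod_cast h'
  -- Conjugating `e i` turns the bilinear pairing `∫ g * e i` into an inner product.
  have hstar : ∀ i, MemLp (fun y => star (e i y)) 2 volume := fun i => (he i).star
  have key := sum_norm_inner_sq_le_of_orthogonal (v := fun i => (hstar i).toLp _) hD0
    (fun i j hij => by
      rw [hL2, ← hort j i hij.symm]
      congr 1 with y
      simp [RCLike.inner_apply, mul_comm])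
    (fun i => by
      rw [hnorm]
      simpa using hD i) s (hg.toLp g)
  rw [hnorm] at key
  refine le_trans (le_of_eq (Finset.sum_congr rfl fun i _ => ?_)) key
  rw [hL2]
  simp [RCLike.inner_apply]

/-! ### Kernels as a decaying weight times an orthogonal family. -/

/-- Two derivatives in frequency become multiplication by `-(2π y)²` in space, so the factor `(a /
2π)²` produces the weight `1 + (a y)²`. -/
theorem exists_schwartzMap_fourierInv_eq_one_add_sq_mul {φ : ℝ → ℂ} (hφ : ContDiff ℝ ∞ φ)
    (hc : HasCompactSupport φ) (a : ℝ) :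
    ∃ Φ : SchwartzMap ℝ ℂ,
      (∀ ξ, Φ ξ = φ ξ - ((a / (2 * Real.pi)) ^ 2 : ℝ) * iteratedDeriv 2 φ ξ) ∧
      ∀ y, 𝓕⁻ (Φ : ℝ → ℂ) y = (1 + (a * y) ^ 2 : ℝ) * 𝓕⁻ φ y := by
  have hsm : ContDiff ℝ ∞ (iteratedDeriv 2 φ) := by
    rw [iteratedDeriv_eq_iterate]
    exact hφ.iterate_deriv 2
  have hcd : HasCompactSupport (iteratedDeriv 2 φ) := by
    rw [iteratedDeriv_eq_iterate]
    exact hc.deriv.deriv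
  have hsm' : ContDiff ℝ ∞ fun ξ => φ ξ - ((a / (2 * Real.pi)) ^ 2 : ℝ) * iteratedDeriv 2 φ ξ :=
    hφ.sub (contDiff_const.mul hsm)
  have hc' : HasCompactSupport fun ξ =>
      φ ξ - ((a / (2 * Real.pi)) ^ 2 : ℝ) * iteratedDeriv 2 φ ξ := hc.sub hcd.mul_left
  refine ⟨hc'.toSchwartzMap hsm', fun _ => rfl, fun y => ?_⟩
  have hint : ∀ n : ℕ, (n : ℕ∞) ≤ ⊤ → Integrable (iteratedDeriv n φ) := by
    intro n _
    have h1 : ContDiff ℝ ∞ (iteratedDeriv n φ) := by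
      rw [iteratedDeriv_eq_iterate]
      exact hφ.iterate_deriv n
    refine h1.continuous.integrable_of_hasCompactSupport ?_
    rw [iteratedDeriv_eq_iterate]
    clear h1
    induction n with
    | zero => exact hc
    | succ n ih =>
      rw [Function.iterate_succ_apply']
      exact (ih le_top).deriv
  have h2 := congrFun (Real.fourier_iteratedDeriv (N := ⊤) (n := 2) hφ hint le_top) (-y)
  have hsub : 𝓕 (fun ξ => φ ξ - ((a / (2 * Real.pi)) ^ 2 : ℝ) * iteratedDeriv 2 φ ξ) (-y) =
      𝓕 φ (-y) - ((a / (2 * Real.pi)) ^ 2 : ℝ) * 𝓕 (iteratedDeriv 2 φ) (-y) := by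
    have h3 := congrArg (fun F : SchwartzMap ℝ ℂ => F (-y))
      ((SchwartzMap.fourierTransformCLM ℂ).map_sub (hc.toSchwartzMap hφ)
        ((((a / (2 * Real.pi)) ^ 2 : ℝ) : ℂ) • hcd.toSchwartzMap hsm))
    rw [(SchwartzMap.fourierTransformCLM ℂ).map_smul] at h3
    exact h3
  rw [Real.fourierInv_eq_fourier_neg, Real.fourierInv_eq_fourier_neg]
  change 𝓕 (fun ξ => φ ξ - ((a / (2 * Real.pi)) ^ 2 : ℝ) * iteratedDeriv 2 φ ξ) (-y) = _
  rw [hsub, h2]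
  have hpi : (Real.pi : ℂ) ≠ 0 := by exact_mod_cast Real.pi_ne_zero
  simp only [smul_eq_mul]
  push_cast
  field_simp
  linear_combination -(a : ℂ) ^ 2 * y ^ 2 * 𝓕 φ (-y) * Complex.I_sq

/-- The functions `φ m` are smooth cutoffs adapted to essentially disjoint compact sets `J m` of
measure at most `a`. -/
structure IsDisjointCutoffs (a B : ℝ) (J : ℤ → Set ℝ) (φ : ℤ → ℝ → ℂ) : Prop where
  pos : 0 < a
  compact : ∀ m, IsCompact (J m)
  volume_le : ∀ m, volume (J m) ≤ ENNReal.ofReal a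
  disjoint : ∀ m n, m ≠ n → volume (J m ∩ J n) = 0
  smooth : ∀ m, ContDiff ℝ ∞ (φ m)
  support_subset : ∀ m, Function.support (φ m) ⊆ J m
  bound : ∀ m ξ, ‖φ m ξ‖ + a ^ 2 * ‖iteratedDeriv 2 (φ m) ξ‖ ≤ B

namespace IsDisjointCutoffs

variable {a B : ℝ} {J : ℤ → Set ℝ} {φ : ℤ → ℝ → ℂ}

theorem hasCompactSupport (h : IsDisjointCutoffs a B J φ) (m : ℤ) : HasCompactSupport (φ m) :=
  HasCompactSupport.of_support_subset_isCompact (h.compact m) (h.support_subset m)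

theorem exists_orthogonal_kernels (h : IsDisjointCutoffs a B J φ) :
    ∃ ψ : ℤ → SchwartzMap ℝ ℂ,
      (∀ m y, 𝓕⁻ (φ m) y = ((1 + (a * y) ^ 2)⁻¹ : ℝ) * ψ m y) ∧
      (∀ m n, m ≠ n → ∫ y, inner ℂ (ψ m y) (ψ n y) = 0) ∧
      ∀ m, ∫ y, ‖ψ m y‖ ^ 2 ≤ B ^ 2 * a := by
  choose Φ hΦ hψ using fun m =>
    exists_schwartzMap_fourierInv_eq_one_add_sq_mul (h.smooth m) (h.hasCompactSupport m) a
  have hΦJ : ∀ m ξ, ξ ∉ J m → Φ m ξ = 0 := by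
    intro m ξ hξ
    have h1 : ξ ∉ tsupport (φ m) := fun hx =>
      hξ (closure_minimal (h.support_subset m) (h.compact m).isClosed hx)
    have h2 : iteratedDeriv 2 (φ m) ξ = 0 := by
      by_contra h3
      refine h1 ?_
      rw [iteratedDeriv_eq_iterate] at h3
      exact (tsupport_deriv_subset.trans tsupport_deriv_subset) (subset_tsupport _ h3)
    rw [hΦ, image_eq_zero_of_notMem_tsupport h1, h2]
    simp
  have hΦB : ∀ m ξ, ‖Φ m ξ‖ ≤ B := by
    intro m ξ
    rw [hΦ]
    refine (norm_sub_le _ _).trans (le_trans ?_ (h.bound m ξ))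
    rw [norm_mul, Complex.norm_real, Real.norm_of_nonneg (sq_nonneg _)]
    -- Since `a / 2π ≤ a`, the bound `B` on the cutoff and its scaled second derivative also
    -- controls `Φ m`.
    have hpi : 1 ≤ 2 * Real.pi := by linarith [Real.pi_gt_three]
    gcongr
    · exact div_nonneg h.pos.le (by positivity)
    · exact div_le_self h.pos.le hpi
  have hP : ∀ m n, ∫ y, inner ℂ ((𝓕⁻ (Φ m) : SchwartzMap ℝ ℂ) y)
      ((𝓕⁻ (Φ n) : SchwartzMap ℝ ℂ) y) = ∫ ξ, inner ℂ (Φ m ξ) (Φ n ξ) := by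
    intro m n
    rw [← SchwartzMap.integral_inner_fourier_fourier]
    simp
  refine ⟨fun m => 𝓕⁻ (Φ m), fun m y => ?_, fun m n hmn => ?_, fun m => ?_⟩
  · have hne : ((1 + (a * y) ^ 2 : ℝ) : ℂ) ≠ 0 := by
      exact_mod_cast (by positivity : (0 : ℝ) < 1 + (a * y) ^ 2).ne'
    rw [SchwartzMap.fourierInv_coe, hψ, Complex.ofReal_inv, inv_mul_cancel_left₀ hne]
  · rw [hP]
    refine integral_eq_zero_of_ae ?_
    have h0 : ∀ᵐ ξ : ℝ, ξ ∉ J m ∩ J n := measure_eq_zero_iff_ae_notMem.1 (h.disjoint m n hmn)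
    filter_upwards [h0] with ξ hξ
    by_cases hm : ξ ∈ J m
    · rw [hΦJ n ξ fun hn => hξ ⟨hm, hn⟩]
      simp
    · rw [hΦJ m ξ hm]
      simp
  · have h1 : ∫ y, ‖(𝓕⁻ (Φ m) : SchwartzMap ℝ ℂ) y‖ ^ 2 = ∫ ξ, ‖Φ m ξ‖ ^ 2 := by
      rw [← SchwartzMap.integral_norm_sq_fourier]
      simp
    rw [h1, ← setIntegral_eq_integral_of_forall_compl_eq_zero (s := J m)
      (fun ξ hξ => by simp [hΦJ m ξ hξ])]
    have hfin : volume (J m) ≠ ⊤ := (h.compact m).measure_lt_top.ne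
    calc ∫ ξ in J m, ‖Φ m ξ‖ ^ 2 ≤ ∫ _ in J m, B ^ 2 := by
          refine setIntegral_mono_on ?_ (integrableOn_const hfin) (h.compact m).measurableSet
            fun ξ _ => ?_
          · exact ((Φ m).continuous.norm.pow 2).continuousOn.integrableOn_compact (h.compact m)
          · gcongr
            exact hΦB m ξ
      _ = volume.real (J m) * B ^ 2 := by rw [setIntegral_const, smul_eq_mul]
      _ ≤ a * B ^ 2 := by
          gcongr
          exact ENNReal.toReal_le_of_le_ofReal h.pos.le (h.volume_le m)
      _ = _ := mul_comm _ _

end IsDisjointCutoffs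

/-! ### Pointwise control of the square function. -/

/-- The square is at most `|f|^p + w`: where `|f| ≤ 1` the integrable weight suffices, elsewhere
`|f|² ≤ |f|^p`. -/
theorem MeasureTheory.MemLp.mul_kernel_memLp_two {p : ℝ} (hp : 2 ≤ p) {f : ℝ → ℂ}
    (hf : MemLp f (ENNReal.ofReal p) volume) {a : ℝ} (ha : 0 < a) (x : ℝ) :
    MemLp (fun y => f y * ((1 + (a * (x - y)) ^ 2)⁻¹ : ℝ)) 2 volume := by
  have hcont : Continuous fun y : ℝ => (1 + (a * (x - y)) ^ 2)⁻¹ :=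
    Continuous.inv₀ (by fun_prop) fun y => by positivity
  have hmeas : AEStronglyMeasurable (fun y => f y * ((1 + (a * (x - y)) ^ 2)⁻¹ : ℝ)) volume :=
    hf.1.mul (Complex.continuous_ofReal.comp hcont).aestronglyMeasurable
  have hw : Integrable fun y : ℝ => (1 + (a * (x - y)) ^ 2)⁻¹ :=
    ((integrable_inv_one_add_sq.comp_mul_left' ha.ne').comp_sub_left x)
  have hfp : Integrable fun y => ‖f y‖ ^ p := by
    have := hf.integrable_norm_rpow (by simp; linarith) ENNReal.ofReal_ne_top
    rwa [ENNReal.toReal_ofReal (by linarith)] at this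
  rw [memLp_two_iff_integrable_sq_norm hmeas]
  refine (hfp.add hw).mono' (hmeas.norm.pow 2) (Filter.Eventually.of_forall fun y => ?_)
  have hw0 : 0 < (1 + (a * (x - y)) ^ 2)⁻¹ := by positivity
  have hw1 : (1 + (a * (x - y)) ^ 2)⁻¹ ≤ 1 :=
    inv_le_one_of_one_le₀ (by nlinarith [sq_nonneg (a * (x - y))])
  simp only [Pi.add_apply]
  set w := (1 + (a * (x - y)) ^ 2)⁻¹
  rw [norm_mul, Complex.norm_real, Real.norm_of_nonneg hw0.le, Real.norm_of_nonneg (by positivity),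
    mul_pow]
  have hww : w ^ 2 ≤ w := by nlinarith
  have hrp : 0 ≤ ‖f y‖ ^ p := by positivity
  rcases le_total ‖f y‖ 1 with h1 | h1
  · have : ‖f y‖ ^ 2 ≤ 1 := pow_le_one₀ (norm_nonneg _) h1
    nlinarith [sq_nonneg w]
  · have : ‖f y‖ ^ 2 ≤ ‖f y‖ ^ p := by
      rw [← Real.rpow_natCast]
      exact Real.rpow_le_rpow_of_exponent_le h1 (by exact_mod_cast hp)
    nlinarith [sq_nonneg w]

namespace IsDisjointCutoffs

variable {a B : ℝ} {J : ℤ → Set ℝ} {φ : ℤ → ℝ → ℂ}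

theorem convolutionExists (h : IsDisjointCutoffs a B J φ) {p : ℝ} (hp : 2 ≤ p) {f : ℝ → ℂ}
    (hf : MemLp f (ENNReal.ofReal p) volume) (m : ℤ) :
    ConvolutionExists f (𝓕⁻ (φ m)) (ContinuousLinearMap.mul ℂ ℂ) volume := by
  obtain ⟨ψ, hψ, -, -⟩ := h.exists_orthogonal_kernels
  intro x
  have h1 : MemLp (fun y => ψ m (x - y)) 2 volume :=
    ((ψ m).memLp 2 volume).comp_measurePreserving (volume.measurePreserving_sub_left x)
  refine ((hf.mul_kernel_memLp_two hp h.pos x).integrable_mul h1).congr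
    (Filter.Eventually.of_forall fun y => ?_)
  simp [hψ, mul_assoc]

/-- Moving the weight from the kernels onto `f` leaves coefficients of `g` against translated,
reflected `ψ m`, still orthogonal; Bessel applies, and `w² ≤ w` simplifies the result. -/
theorem tsum_enorm_freqProj_sq_le (h : IsDisjointCutoffs a B J φ) {p : ℝ} (hp : 2 ≤ p) {f : ℝ → ℂ}
    (hf : MemLp f (ENNReal.ofReal p) volume) (x : ℝ) :
    (∑' m, ‖freqProj (φ m) f x‖ₑ ^ 2) ≤ ENNReal.ofReal (B ^ 2) * (ENNReal.ofReal a *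
      ∫⁻ y, ‖f y‖ₑ ^ 2 * ENNReal.ofReal (1 + (a * (x - y)) ^ 2)⁻¹) ∧
    (∑' m, ‖freqProj (φ m) f x‖ₑ ^ 2) ≠ ⊤ := by
  obtain ⟨ψ, hψ, hort, hD⟩ := h.exists_orthogonal_kernels
  set g : ℝ → ℂ := fun y => f y * ((1 + (a * (x - y)) ^ 2)⁻¹ : ℝ) with hg
  have hg2 : MemLp g 2 volume := hf.mul_kernel_memLp_two hp h.pos x
  have hsq : ∀ z : ℂ, ‖z‖ₑ ^ 2 = ENNReal.ofReal (‖z‖ ^ 2) := fun z => by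
    rw [ENNReal.ofReal_pow (norm_nonneg _), ofReal_norm]
  have hle : (∑' m, ‖freqProj (φ m) f x‖ₑ ^ 2) ≤
      ENNReal.ofReal (B ^ 2 * a * ∫ y, ‖g y‖ ^ 2) := by
    rw [ENNReal.tsum_eq_iSup_sum]
    refine iSup_le fun s => ?_
    simp_rw [hsq]
    rw [← ENNReal.ofReal_sum_of_nonneg fun _ _ => by positivity]
    refine ENNReal.ofReal_le_ofReal ?_
    refine le_trans (le_of_eq (Finset.sum_congr rfl fun m _ => ?_))
      (sum_norm_integral_mul_sq_le (e := fun m y => ψ m (x - y)) (g := g) (D := B ^ 2 * a)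
        (mul_nonneg (sq_nonneg B) h.pos.le)
        (fun m => ((ψ m).memLp 2 volume).comp_measurePreserving
          (volume.measurePreserving_sub_left x))
        (fun m n hmn => ?_) (fun m => ?_) hg2 s)
    · congr 2
      refine integral_congr_ae (Filter.Eventually.of_forall fun y => ?_)
      simp [hψ, hg, mul_assoc]
    · rw [integral_sub_left_eq_self (fun y => inner ℂ (ψ m y) (ψ n y))]
      exact hort m n hmn
    · rw [integral_sub_left_eq_self (fun y => ‖ψ m y‖ ^ 2)]
      exact hD m
  refine ⟨hle.trans ?_, (hle.trans_lt ENNReal.ofReal_lt_top).ne⟩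
  rw [ENNReal.ofReal_mul (mul_nonneg (sq_nonneg B) h.pos.le), ENNReal.ofReal_mul (sq_nonneg B),
    mul_assoc, ofReal_integral_eq_lintegral_ofReal
      ((memLp_two_iff_integrable_sq_norm hg2.1).1 hg2)
      (Filter.Eventually.of_forall fun _ => by positivity)]
  gcongr with y
  have hw0 : 0 < (1 + (a * (x - y)) ^ 2)⁻¹ := by positivity
  have hw1 : (1 + (a * (x - y)) ^ 2)⁻¹ ≤ 1 :=
    inv_le_one_of_one_le₀ (by nlinarith [sq_nonneg (a * (x - y))])
  rw [hsq, ← ENNReal.ofReal_mul (by positivity)]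
  refine ENNReal.ofReal_le_ofReal ?_
  rw [hg, norm_mul, Complex.norm_real, Real.norm_of_nonneg hw0.le, mul_pow]
  gcongr
  nlinarith

end IsDisjointCutoffs

theorem measurable_freqProj {φ : ℝ → ℂ} (hφ : Continuous (𝓕⁻ φ)) {f : ℝ → ℂ}
    (hf : AEStronglyMeasurable f volume) : Measurable (freqProj φ f) := by
  have h : freqProj φ f = fun x => ∫ y, hf.mk f y * 𝓕⁻ φ (x - y) := by
    ext x
    refine integral_congr_ae ?_
    filter_upwards [hf.ae_eq_mk] with y hy
    rw [← hy]
    rfl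
  rw [h]
  refine (StronglyMeasurable.integral_prod_right'
    (f := fun z : ℝ × ℝ => hf.mk f z.2 * 𝓕⁻ φ (z.1 - z.2)) ?_).measurable
  exact (hf.stronglyMeasurable_mk.comp_measurable measurable_snd).mul
    (hφ.comp (by fun_prop)).stronglyMeasurable

/-! ### Grid intervals and their cutoffs. -/

theorem reflectedGridInterval_eq_gridInterval (θ : ℝ) (k m : ℤ) :
    reflectedGridInterval θ k m = gridInterval (-θ - 1) k (-m) := by
  ext ξ
  simp only [reflectedGridInterval, gridInterval, Set.mem_ofPred_eq, Set.mem_Icc]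
  push_cast
  constructor <;> rintro ⟨h1, h2⟩ <;> constructor <;> linarith

theorem volume_gridInterval (θ : ℝ) (k m : ℤ) :
    volume (gridInterval θ k m) = ENNReal.ofReal ((2 : ℝ) ^ k) := by
  rw [gridInterval, Real.volume_Icc]
  congr 1
  ring

theorem volume_gridInterval_inter_gridInterval (θ : ℝ) (k : ℤ) {m n : ℤ} (h : m ≠ n) :
    volume (gridInterval θ k m ∩ gridInterval θ k n) = 0 := by
  wlog hmn : m < n generalizing m n
  · rw [Set.inter_comm]
    exact this h.symm (by omega)
  refine measure_mono_null (t := {(2 : ℝ) ^ k * (n + θ)}) ?_ (measure_singleton _)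
  rintro ξ ⟨⟨-, h1⟩, ⟨h2, -⟩⟩
  have h3 : (m : ℝ) + 1 ≤ n := by exact_mod_cast hmn
  have h4 : (2 : ℝ) ^ k * (m + θ + 1) ≤ 2 ^ k * (n + θ) := by
    refine mul_le_mul_of_nonneg_left ?_ (by positivity)
    linarith
  exact le_antisymm (h1.trans h4) h2

namespace IsAdaptedFamily

variable {C : ℕ → ℝ} {θ : ℝ} {φ : ℤ → ℤ → ℝ → ℂ}

/-- Only the derivative bounds of orders 0 and 2 enter, so `B = C 0 + C 2`, independent of the scale
and the offset. -/
theorem isDisjointCutoffs_of_volume {J : ℤ → ℤ → Set ℝ} (h : IsAdaptedFamily C J φ) (k : ℤ)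
    (hc : ∀ m, IsCompact (J k m)) (hv : ∀ m, volume (J k m) ≤ ENNReal.ofReal ((2 : ℝ) ^ k))
    (hd : ∀ m n, m ≠ n → volume (J k m ∩ J k n) = 0) :
    IsDisjointCutoffs ((2 : ℝ) ^ k) (C 0 + C 2) (J k) (φ k) where
  pos := by positivity
  compact := hc
  volume_le := hv
  disjoint := hd
  smooth := h.smooth k
  support_subset := h.support_subset k
  bound m ξ := by
    have h0 := h.bound 0 k m ξ
    have h2 := h.bound 2 k m ξ
    simp only [iteratedDeriv_zero, pow_zero, inv_one, mul_one] at h0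
    rw [← div_eq_mul_inv, le_div_iff₀ (by positivity), mul_comm] at h2
    exact add_le_add h0 h2

theorem isDisjointCutoffs (h : IsAdaptedFamily C (gridInterval θ) φ) (k : ℤ) :
    IsDisjointCutoffs ((2 : ℝ) ^ k) (C 0 + C 2) (gridInterval θ k) (φ k) :=
  h.isDisjointCutoffs_of_volume k (fun _ => isCompact_Icc) (fun m => (volume_gridInterval θ k m).le)
    fun _ _ => volume_gridInterval_inter_gridInterval θ k

theorem isDisjointCutoffs_reflected (h : IsAdaptedFamily C (reflectedGridInterval θ) φ) (k : ℤ) :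
    IsDisjointCutoffs ((2 : ℝ) ^ k) (C 0 + C 2) (reflectedGridInterval θ k) (φ k) := by
  refine h.isDisjointCutoffs_of_volume k (fun m => ?_) (fun m => ?_) fun m n hmn => ?_
  · rw [reflectedGridInterval_eq_gridInterval]
    exact isCompact_Icc
  · rw [reflectedGridInterval_eq_gridInterval, volume_gridInterval]
  · rw [reflectedGridInterval_eq_gridInterval, reflectedGridInterval_eq_gridInterval]
    exact volume_gridInterval_inter_gridInterval _ k (neg_injective.ne hmn)

end IsAdaptedFamily

/-! ### The maximal square function and the bilinear estimate. -/

theorem ENNReal.tsum_mul_le_sqrt_mul_sqrt (u v : ℤ → ℝ≥0∞) :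
    ∑' m, u m * v m ≤ (∑' m, u m ^ 2) ^ (1 / 2 : ℝ) * (∑' m, v m ^ 2) ^ (1 / 2 : ℝ) := by
  have h := ENNReal.lintegral_mul_le_Lp_mul_Lq (Measure.count : Measure ℤ)
    Real.HolderConjugate.two_two (f := u) (g := v) (measurable_of_countable _).aemeasurable
    (measurable_of_countable _).aemeasurable
  simpa [lintegral_count] using h

/-- The constant in the maximal square function estimate. -/
noncomputable def squareConst (B p : ℝ) : ℝ≥0∞ :=
  ((ENNReal.ofReal (B ^ 2) * 16) ^ (p / 2) *
    ENNReal.ofReal (8 * (p / 2) / (p / 2 - 1) * 2 ^ (p / 2 - 1))) ^ (1 / p)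

theorem squareConst_ne_top {B p : ℝ} (hp : 0 ≤ p) : squareConst B p ≠ ⊤ := by
  refine ENNReal.rpow_ne_top_of_nonneg (by positivity) (ENNReal.mul_ne_top ?_ ENNReal.ofReal_ne_top)
  exact ENNReal.rpow_ne_top_of_nonneg (by positivity)
    (ENNReal.mul_ne_top ENNReal.ofReal_ne_top (by simp))

/-- One majorant serves all scales: `G = (16 B² M(|f|²))^(1/2)`. Its `L^p` bound is the maximal
theorem for `|f|²` at exponent `p / 2 > 1`, which is where `p > 2` is needed. -/
theorem exists_measurable_bound_square_function {p : ℝ} (hp : 2 < p) {B : ℝ} {f : ℝ → ℂ}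
    (hf : MemLp f (ENNReal.ofReal p) volume) {J : ℤ → ℤ → Set ℝ} {φ : ℤ → ℤ → ℝ → ℂ}
    (h : ∀ k : ℤ, IsDisjointCutoffs ((2 : ℝ) ^ k) B (J k) (φ k)) :
    ∃ G : ℝ → ℝ≥0∞, Measurable G ∧
      (∀ k x, (∑' m, ‖freqProj (φ k m) f x‖ₑ ^ 2) ^ (1 / 2 : ℝ) ≤ G x) ∧
      (∫⁻ x, G x ^ p) ^ (1 / p) ≤ squareConst B p * eLpNorm f (ENNReal.ofReal p) volume := by
  have hp0 : 0 < p := by linarith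
  obtain ⟨f', hf', hff'⟩ := hf.aestronglyMeasurable
  set F : ℝ → ℝ≥0∞ := fun y => ‖f' y‖ₑ ^ 2 with hF
  have hFm : Measurable F := hf'.enorm.pow_const 2
  have hM := measurable_dyadicMaximal hFm
  refine ⟨fun x => (ENNReal.ofReal (B ^ 2) * (16 * dyadicMaximal F x)) ^ (1 / 2 : ℝ),
    ((hM.const_mul _).const_mul _).pow_const _, fun k x => ?_, ?_⟩
  · refine ENNReal.rpow_le_rpow ?_ (by norm_num)
    refine ((h k).tsum_enorm_freqProj_sq_le hp.le hf x).1.trans (mul_le_mul' le_rfl ?_)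
    refine le_trans (le_of_eq ?_) (lintegral_mul_kernel_le_dyadicMaximal hFm k x)
    congr 1
    refine lintegral_congr_ae ?_
    filter_upwards [hff'] with y hy
    rw [hy]
  · have hnorm : eLpNorm f (ENNReal.ofReal p) volume = (∫⁻ x, F x ^ (p / 2)) ^ (1 / p) := by
      rw [eLpNorm_eq_lintegral_rpow_enorm_toReal (by simpa using hp0) ENNReal.ofReal_ne_top,
        ENNReal.toReal_ofReal hp0.le]
      congr 1
      refine lintegral_congr_ae ?_
      filter_upwards [hff'] with y hy
      rw [hy]
      simp only [hF]
      rw [← ENNReal.rpow_natCast, ← ENNReal.rpow_mul]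
      congr 1
      push_cast
      ring
    rw [hnorm, squareConst, ← ENNReal.mul_rpow_of_nonneg _ _ (by positivity)]
    refine ENNReal.rpow_le_rpow ?_ (by positivity)
    rw [mul_assoc]
    refine le_trans (le_of_eq ?_)
      (mul_le_mul' le_rfl (lintegral_dyadicMaximal_rpow_le (by linarith : 1 < p / 2) hFm))
    rw [← lintegral_const_mul _ (hM.pow_const _)]
    congr 1 with x
    rw [← ENNReal.rpow_mul, ← mul_assoc, ENNReal.mul_rpow_of_nonneg _ _ (by positivity)]
    congr 2 <;> ring

theorem tsum_enorm_tileTerm_le (φ₁ φ₂ : ℤ → ℤ → ℝ → ℂ) (f₁ f₂ : ℝ → ℂ) (k : ℤ) (x : ℝ) :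
    ∑' m, ‖tileTerm φ₁ φ₂ f₁ f₂ k m x‖ₑ ≤
      (∑' m, ‖freqProj (φ₁ k m) f₁ x‖ₑ ^ 2) ^ (1 / 2 : ℝ) *
        (∑' m, ‖freqProj (φ₂ k m) f₂ x‖ₑ ^ 2) ^ (1 / 2 : ℝ) := by
  simp_rw [tileTerm, enorm_mul]
  exact ENNReal.tsum_mul_le_sqrt_mul_sqrt _ _

theorem summable_norm_iff_tsum_enorm_ne_top {u : ℤ → ℂ} :
    (Summable fun m => ‖u m‖) ↔ ∑' m, ‖u m‖ₑ ≠ ⊤ := by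
  simp_rw [enorm_eq_nnnorm, ENNReal.tsum_coe_ne_top_iff_summable]
  exact NNReal.summable_coe (f := fun m => ‖u m‖₊)

theorem summable_norm_tileTerm {p₁ p₂ : ℝ} (hp₁ : 2 ≤ p₁) (hp₂ : 2 ≤ p₂) {a B : ℝ} {k : ℤ}
    {J₁ J₂ : ℤ → Set ℝ} {φ₁ φ₂ : ℤ → ℤ → ℝ → ℂ} (h₁ : IsDisjointCutoffs a B J₁ (φ₁ k))
    (h₂ : IsDisjointCutoffs a B J₂ (φ₂ k)) {f₁ f₂ : ℝ → ℂ}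
    (hf₁ : MemLp f₁ (ENNReal.ofReal p₁) volume) (hf₂ : MemLp f₂ (ENNReal.ofReal p₂) volume)
    (x : ℝ) : Summable fun m : ℤ => ‖tileTerm φ₁ φ₂ f₁ f₂ k m x‖ := by
  refine summable_norm_iff_tsum_enorm_ne_top.2
    (ne_top_of_le_ne_top (ENNReal.mul_ne_top ?_ ?_) (tsum_enorm_tileTerm_le φ₁ φ₂ f₁ f₂ k x))
  · exact ENNReal.rpow_ne_top_of_nonneg (by norm_num) (h₁.tsum_enorm_freqProj_sq_le hp₁ hf₁ x).2
  · exact ENNReal.rpow_ne_top_of_nonneg (by norm_num) (h₂.tsum_enorm_freqProj_sq_le hp₂ hf₂ x).2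

theorem measurable_tileTerm {a B : ℝ} {k : ℤ} {J₁ J₂ : ℤ → Set ℝ} {φ₁ φ₂ : ℤ → ℤ → ℝ → ℂ}
    (h₁ : IsDisjointCutoffs a B J₁ (φ₁ k)) (h₂ : IsDisjointCutoffs a B J₂ (φ₂ k))
    {f₁ f₂ : ℝ → ℂ} (hf₁ : AEStronglyMeasurable f₁ volume) (hf₂ : AEStronglyMeasurable f₂ volume)
    (m : ℤ) : Measurable (tileTerm φ₁ φ₂ f₁ f₂ k m) := by
  have hcont : ∀ {J : ℤ → Set ℝ} {φ : ℤ → ℝ → ℂ}, IsDisjointCutoffs a B J φ →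
      Continuous (𝓕⁻ (φ m)) := by
    intro J φ h
    have := (𝓕⁻ ((h.hasCompactSupport m).toSchwartzMap (h.smooth m)) : SchwartzMap ℝ ℂ).continuous
    rw [SchwartzMap.fourierInv_coe] at this
    exact this
  exact (measurable_freqProj (hcont h₁) hf₁).mul (measurable_freqProj (hcont h₂) hf₂)

theorem maxBilinear_add_le {φ₁ φ₂ : ℤ → ℤ → ℝ → ℂ} {f g h f₂ g₂ h₂ : ℝ → ℂ} {x : ℝ}
    (hadd : ∀ k m, tileTerm φ₁ φ₂ f f₂ k m x =
      tileTerm φ₁ φ₂ g g₂ k m x + tileTerm φ₁ φ₂ h h₂ k m x)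
    (hg : ∀ k, Summable fun m : ℤ => ‖tileTerm φ₁ φ₂ g g₂ k m x‖)
    (hh : ∀ k, Summable fun m : ℤ => ‖tileTerm φ₁ φ₂ h h₂ k m x‖) :
    maxBilinear φ₁ φ₂ f f₂ x ≤ maxBilinear φ₁ φ₂ g g₂ x + maxBilinear φ₁ φ₂ h h₂ x := by
  refine iSup_le fun k => ?_
  simp_rw [hadd]
  rw [(hg k).of_norm.tsum_add (hh k).of_norm]
  refine (enorm_add_le _ _).trans (add_le_add ?_ ?_)
  · exact le_iSup (fun k : ℤ => ‖∑' m : ℤ, tileTerm φ₁ φ₂ g g₂ k m x‖ₑ) k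
  · exact le_iSup (fun k : ℤ => ‖∑' m : ℤ, tileTerm φ₁ φ₂ h h₂ k m x‖ₑ) k

theorem maxBilinear_smul {φ₁ φ₂ : ℤ → ℤ → ℝ → ℂ} {f g f₂ g₂ : ℝ → ℂ} {c : ℂ} {x : ℝ}
    (hsmul : ∀ k m, tileTerm φ₁ φ₂ f f₂ k m x = c * tileTerm φ₁ φ₂ g g₂ k m x) :
    maxBilinear φ₁ φ₂ f f₂ x = ‖c‖ₑ * maxBilinear φ₁ φ₂ g g₂ x := by
  simp_rw [maxBilinear, hsmul, tsum_mul_left, enorm_mul, ENNReal.mul_iSup]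

theorem freqProj_smul (φ f : ℝ → ℂ) (c : ℂ) (x : ℝ) :
    freqProj φ (c • f) x = c * freqProj φ f x := by
  rw [freqProj, smul_convolution]
  rfl

theorem eLpNorm_le_of_le_mul {p₁ p₂ : ℝ} (hp₁ : 0 < p₁) (hp₂ : 0 < p₂) {F G₁ G₂ : ℝ → ℝ≥0∞}
    (h₁ : Measurable G₁) (h₂ : Measurable G₂) (hF : ∀ x, F x ≤ G₁ x * G₂ x) :
    eLpNorm F (ENNReal.ofReal (p₁ * p₂ / (p₁ + p₂))) volume ≤
      (∫⁻ x, G₁ x ^ p₁) ^ (1 / p₁) * (∫⁻ x, G₂ x ^ p₂) ^ (1 / p₂) := by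
  have hq : 0 < p₁ * p₂ / (p₁ + p₂) := by positivity
  rw [eLpNorm_eq_lintegral_rpow_enorm_toReal (by simpa using hq) ENNReal.ofReal_ne_top,
    ENNReal.toReal_ofReal hq.le]
  refine le_trans (ENNReal.rpow_le_rpow (lintegral_mono fun x => ?_) (by positivity))
    (ENNReal.lintegral_Lp_mul_le_Lq_mul_Lr hq ?_ ?_ volume h₁.aemeasurable h₂.aemeasurable)
  · exact ENNReal.rpow_le_rpow (by simpa using hF x) hq.le
  · rw [div_lt_iff₀ (by positivity)]
    nlinarith
  · field_simp
    ring

theorem mainTheorem6 (p₁ p₂ : ℝ) (hp₁ : 2 < p₁) (hp₂ : 2 < p₂) (C : ℕ → ℝ) :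
    ∃ K : ℝ≥0, ∀ (θ : ℝ) (φ₁ φ₂ : ℤ → ℤ → ℝ → ℂ),
      IsAdaptedFamily C (gridInterval θ) φ₁ →
      IsAdaptedFamily C (reflectedGridInterval θ) φ₂ →
      -- the operator is well defined and bounded
      (∀ f₁ f₂ : ℝ → ℂ,
        MemLp f₁ (ENNReal.ofReal p₁) volume → MemLp f₂ (ENNReal.ofReal p₂) volume →
          (∀ k m : ℤ,
            ConvolutionExists f₁ (𝓕⁻ (φ₁ k m)) (ContinuousLinearMap.mul ℂ ℂ) volume ∧
            ConvolutionExists f₂ (𝓕⁻ (φ₂ k m)) (ContinuousLinearMap.mul ℂ ℂ) volume) ∧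
          (∀ (k : ℤ) (x : ℝ), Summable fun m : ℤ => ‖tileTerm φ₁ φ₂ f₁ f₂ k m x‖) ∧
          AEMeasurable (maxBilinear φ₁ φ₂ f₁ f₂) volume ∧
          eLpNorm (maxBilinear φ₁ φ₂ f₁ f₂) (ENNReal.ofReal (p₁ * p₂ / (p₁ + p₂))) volume ≤
            K * eLpNorm f₁ (ENNReal.ofReal p₁) volume * eLpNorm f₂ (ENNReal.ofReal p₂) volume) ∧
      -- the operator is sublinear in the first argument
      (∀ (f g h : ℝ → ℂ) (c : ℂ) (x : ℝ),
        MemLp f (ENNReal.ofReal p₁) volume → MemLp g (ENNReal.ofReal p₁) volume →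
        MemLp h (ENNReal.ofReal p₂) volume →
          maxBilinear φ₁ φ₂ (f + g) h x ≤
            maxBilinear φ₁ φ₂ f h x + maxBilinear φ₁ φ₂ g h x ∧
          maxBilinear φ₁ φ₂ (c • f) h x = ‖c‖ₑ * maxBilinear φ₁ φ₂ f h x) ∧
      -- the operator is sublinear in the second argument
      (∀ (f g h : ℝ → ℂ) (c : ℂ) (x : ℝ),
        MemLp f (ENNReal.ofReal p₁) volume → MemLp g (ENNReal.ofReal p₂) volume →
        MemLp h (ENNReal.ofReal p₂) volume →
          maxBilinear φ₁ φ₂ f (g + h) x ≤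
            maxBilinear φ₁ φ₂ f g x + maxBilinear φ₁ φ₂ f h x ∧
          maxBilinear φ₁ φ₂ f (c • g) x = ‖c‖ₑ * maxBilinear φ₁ φ₂ f g x) := by
  have hK₁ := squareConst_ne_top (B := C 0 + C 2) (by linarith : 0 ≤ p₁)
  have hK₂ := squareConst_ne_top (B := C 0 + C 2) (by linarith : 0 ≤ p₂)
  refine ⟨(squareConst (C 0 + C 2) p₁ * squareConst (C 0 + C 2) p₂).toNNReal,
    fun θ φ₁ φ₂ h₁ h₂ => ?_⟩
  have hd₁ := h₁.isDisjointCutoffs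
  have hd₂ := h₂.isDisjointCutoffs_reflected
  have hsum : ∀ {f₁ f₂ : ℝ → ℂ}, MemLp f₁ (ENNReal.ofReal p₁) volume →
      MemLp f₂ (ENNReal.ofReal p₂) volume → ∀ (x : ℝ) (k : ℤ),
      Summable fun m : ℤ => ‖tileTerm φ₁ φ₂ f₁ f₂ k m x‖ := fun hf₁ hf₂ x k =>
    summable_norm_tileTerm hp₁.le hp₂.le (hd₁ k) (hd₂ k) hf₁ hf₂ x
  refine ⟨fun f₁ f₂ hf₁ hf₂ => ⟨fun k m => ⟨(hd₁ k).convolutionExists hp₁.le hf₁ m,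
    (hd₂ k).convolutionExists hp₂.le hf₂ m⟩, fun k x => hsum hf₁ hf₂ x k, ?_, ?_⟩,
    fun f g h c x hf hg hh => ⟨?_, ?_⟩, fun f g h c x hf hg hh => ⟨?_, ?_⟩⟩
  · refine (Measurable.iSup fun k => Measurable.enorm ?_).aemeasurable
    exact Measurable.tsum fun m => measurable_tileTerm (hd₁ k) (hd₂ k) hf₁.1 hf₂.1 m
  · obtain ⟨G₁, hG₁, hle₁, hb₁⟩ := exists_measurable_bound_square_function hp₁ hf₁ hd₁
    obtain ⟨G₂, hG₂, hle₂, hb₂⟩ := exists_measurable_bound_square_function hp₂ hf₂ hd₂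
    refine (eLpNorm_le_of_le_mul (by linarith) (by linarith) hG₁ hG₂ fun x => ?_).trans
      ((mul_le_mul' hb₁ hb₂).trans (le_of_eq ?_))
    · refine iSup_le fun k => enorm_tsum_le_tsum_enorm.trans ?_
      exact (tsum_enorm_tileTerm_le φ₁ φ₂ f₁ f₂ k x).trans (mul_le_mul' (hle₁ k x) (hle₂ k x))
    · rw [ENNReal.coe_toNNReal (ENNReal.mul_ne_top hK₁ hK₂)]
      ring
  · refine maxBilinear_add_le (fun k m => ?_) (hsum hf hh x) (hsum hg hh x)
    simp only [tileTerm, freqProj]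
    rw [((hd₁ k).convolutionExists hp₁.le hf m x).add_distrib
      ((hd₁ k).convolutionExists hp₁.le hg m x), add_mul]
  · refine maxBilinear_smul fun k m => ?_
    rw [tileTerm, freqProj_smul, mul_assoc, tileTerm]
  · refine maxBilinear_add_le (fun k m => ?_) (hsum hf hg x) (hsum hf hh x)
    simp only [tileTerm, freqProj]
    rw [((hd₂ k).convolutionExists hp₂.le hg m x).add_distrib
      ((hd₂ k).convolutionExists hp₂.le hh m x), mul_add]
  · refine maxBilinear_smul fun k m => ?_
    rw [tileTerm, freqProj_smul, mul_left_comm, tileTerm]
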